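/- Let $k\ge 2$ and $n_1,\dots,n_k\ge 2$ be integers. For a complex Hilbert space $\mathcal H$, consider tuples $T=(T_1,\dots,T_k)$ with $T_i=(T_{i,1},\dots,T_{i,n_i})\in B(\mathcal H)^{n_i}$, and put $\Phi_{T_i}(Y)=\sum_{j=1}^{n_i}T_{i,j}\,Y\,T_{i,j}^*$ for $Y\in B(\mathcal H)$. The regular polyball $\mathbf B_{\mathbf n}(\mathcal H)$ is the set of all such $T$ for which $T_{s,a}$ commutes with $T_{r,b}$ whenever $s\ne r$, and $(\mathrm{id}-\Phi_{T_1})^{p_1}\circ\cdots\circ(\mathrm{id}-\Phi_{T_k})^{p_k}(I)\ge 0$ for all $p\in\{0,1\}^k$. Such a $T$ is pure if $\Phi_{T_i}^m(I)\to 0$ strongly as $m\to\infty$ for every $i$. Its defect operator is $\Delta_T(I)=(\mathrm{id}-\Phi_{T_1})\circ\cdots\circ(\mathrm{id}-\Phi_{T_k})(I)$, and its rank is the rank of $\Delta_T(I)$. For a word $\alpha=g_{j_1}\cdots g_{j_p}$ in the free monoid on $n_i$ generators write $|\alpha|=p$ and $T_{i,\alpha}=T_{i,j_1}\cdots T_{i,j_p}$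 (with $T_{i,\alpha}=I$ for the empty word). For $q\in\mathbb Z_{\ge 0}^k$ let $M_q(T)$ be the linear span of all vectors $T_{1,\alpha_1}\cdots T_{k,\alpha_k}h$ with $|\alpha_i|\le q_i$ and $h\in\Delta_T(I)(\mathcal H)$. For $T$ of finite rank, the Euler characteristic is $$\chi(T)=\lim_{m\to\infty}\frac{\dim M_{q^{(m)}}(T)}{\prod_{i=1}^k\left(1+n_i+\cdots+n_i^{q^{(m)}_i}\right)},$$ where $(q^{(m)})_m$ is any increasing cofinal sequence in $\mathbb Z_{\ge 0}^k$ (with the coordinatewise order), provided that the limit exists and does not depend on the sequence. Two tuples $T$ on $\mathcal H$ and $T'$ on $\mathcal H'$ are unitarily equivalent if there is a unitary $U:\mathcal H\to\mathcal H'$ with $UT_{i,j}=T'_{i,j}U$ for all $i,j$. Then for each $t\in(0,1)$ there exists an uncountable family $\{T^{(\omega)}\}_{\omega\in\Omega}$ of pure elements of the regular polyball (each $T^{(\omega)}$ acting on some complex Hilbert space $\mathcal H_\omega$) such that (i) $T^{(\omega)}$ is not unitarily equivalent to $T^{(\sigma)}$ for any $\omega,\sigma\in\Omega$ with $\omega\ne\sigma$;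 (ii) for every $\omega\in\Omega$, $T^{(\omega)}$ has rank $1$, and $\chi(T^{(\omega)})$ exists and equals $t$. -/

import Mathlib

namespace Polyball

variable {H : Type*} [NormedAddCommGroup H] [InnerProductSpace ℂ H] [CompleteSpace H]
variable {k : ℕ} {n : Fin k → ℕ}

/-- The map `Φ_X(Y) = ∑ j, X_j Y X_j^*` on `B(H)` associated with `X = (X_1, …, X_m)`. -/
noncomputable def Phi {m : ℕ} (X : Fin m → (H →L[ℂ] H)) : Module.End ℂ (H →L[ℂ] H) where
  toFun Y := ∑ j, X j * Y * ContinuousLinearMap.adjoint (X j)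
  map_add' Y Z := by simp [mul_add, add_mul, Finset.sum_add_distrib]
  map_smul' c Y := by simp [Finset.smul_sum]

/-- The defect mapping `Δ_T^p = (id - Φ_{T_1})^{p_1} ∘ ⋯ ∘ (id - Φ_{T_k})^{p_k}`
(multiplication in `Module.End` is composition). -/
noncomputable def defectMap (T : ∀ i, Fin (n i) → (H →L[ℂ] H)) (p : Fin k → ℕ) :
    Module.End ℂ (H →L[ℂ] H) :=
  (List.ofFn fun i => (1 - Phi (T i)) ^ p i).prod

/-- The defect operator `Δ_T(I) = (id - Φ_{T_1}) ∘ ⋯ ∘ (id - Φ_{T_k}) (I)`. -/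
noncomputable def defect (T : ∀ i, Fin (n i) → (H →L[ℂ] H)) : H →L[ℂ] H :=
  defectMap T (fun _ => 1) 1

/-- Membership in the regular polyball `B_n(H)`: operators from different groups commute (no
commutation is asked within a group), and `Δ_T^p(I) ≥ 0` for all `0 ≤ p ≤ (1, …, 1)`. -/
structure InPolyball (T : ∀ i, Fin (n i) → (H →L[ℂ] H)) : Prop where
  commute : ∀ s t, s ≠ t → ∀ a b, Commute (T s a) (T t b)
  defect_nonneg : ∀ p : Fin k → ℕ, (∀ i, p i ≤ 1) → (defectMap T p 1).IsPositive

/-- `T` is pure: `Φ_{T_i}^m(I) → 0` in the strong operator topology, for every `i`. -/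
def IsPure (T : ∀ i, Fin (n i) → (H →L[ℂ] H)) : Prop :=
  ∀ i (h : H), Filter.Tendsto (fun m : ℕ => (Phi (T i) ^ m) 1 h) Filter.atTop (nhds 0)

/-- The rank of `T`, that is, the rank of its defect operator. -/
noncomputable def rank (T : ∀ i, Fin (n i) → (H →L[ℂ] H)) : Cardinal :=
  (defect T).toLinearMap.rank

/-- For words `α_i` in the free monoid on `n_i` letters, the operator
`T_{1,α_1} ⋯ T_{k,α_k}`, where `T_{i,α} = T_{i,j_1} ⋯ T_{i,j_p}` if `α = g_{j_1} ⋯ g_{j_p}`. -/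
noncomputable def wordOp (T : ∀ i, Fin (n i) → (H →L[ℂ] H)) (α : ∀ i, List (Fin (n i))) :
    H →L[ℂ] H :=
  (List.ofFn fun i => ((α i).map (T i)).prod).prod

/-- `M_q(T)`, the span of all `T_{1,α_1} ⋯ T_{k,α_k} h` with `|α_i| ≤ q_i` and `h` in the range
of the defect operator. -/
noncomputable def M (T : ∀ i, Fin (n i) → (H →L[ℂ] H)) (q : Fin k → ℕ) : Submodule ℂ H :=
  Submodule.span ℂ
    {x | ∃ α : ∀ i, List (Fin (n i)), (∀ i, (α i).length ≤ q i) ∧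
      ∃ h ∈ Set.range (defect T), x = wordOp T α h}

/-- The quotient `dim M_q(T) / ∏ i, (1 + n_i + ⋯ + n_i ^ q_i)`. (The dimension is finite if `T`
has finite rank.) -/
noncomputable def eulerRatio (T : ∀ i, Fin (n i) → (H →L[ℂ] H)) (q : Fin k → ℕ) : ℝ :=
  (Module.finrank ℂ (M T q) : ℝ) / ∏ i, ∑ s ∈ Finset.range (q i + 1), (n i : ℝ) ^ s

/-- The Euler characteristic of the finite rank tuple `T` exists and equals `c`: along every
increasing cofinal sequence in `ℕ^k` the quotients above converge to `c`. -/
def HasEulerCharacteristic (T : ∀ i, Fin (n i) → (H →L[ℂ] H)) (c : ℝ) : Prop :=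
  rank T < Cardinal.aleph0 ∧
  ∀ q : ℕ → (Fin k → ℕ), Monotone q → (∀ p, ∃ m, p ≤ q m) →
    Filter.Tendsto (fun m => eulerRatio T (q m)) Filter.atTop (nhds c)

/-- Unitary equivalence of tuples of operators, possibly on different Hilbert spaces. -/
def UnitarilyEquivalent {H' : Type*} [NormedAddCommGroup H'] [InnerProductSpace ℂ H']
    (T : ∀ i, Fin (n i) → (H →L[ℂ] H)) (T' : ∀ i, Fin (n i) → (H' →L[ℂ] H')) : Prop :=
  ∃ U : H ≃ₗᵢ[ℂ] H', ∀ i j h, U (T i j h) = T' i j (U h)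

end Polyball

/-! Let A be a set of word tuples closed under deleting first letters. Compressing the creation
operators to ℓ²(A) gives operators sending e_α to e_{g_j α}, or to 0 when that leaves A. The maps
Φ_i preserve diagonal operators, so all Δ^p(I) and Φ_i^m(I) are explicit 0-1 diagonal operators.
This yields membership in the polyball, purity, and rank 1: the defect operator projects onto the
vacuum line (`defect_shift_apply`). Moreover M_q has basis e_α with α ∈ A and |α_i| ≤ q_i, so χ is
the asymptotic density of A (`finrank_M_shift`).

The set A is a unitary invariant (`eq_of_unitarilyEquivalent`): the vacuum line is the
orthocomplement of the ranges of the operators, and α ∈ A exactly when the word operator of α does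
not kill it.

It remains to find uncountably many A of density t. In one free monoid, the words whose base n value
lies below the fraction c have density c (`tendsto_cutWords_ratio`). Products of such sets have
density ∏ c_i, and t = s · (t / s) for every s in (t, 1). -/

namespace Polyball

/-- Tuples of words, one in each of the free monoids on `n i` letters. -/
abbrev Words {k : ℕ} (n : Fin k → ℕ) : Type := ∀ i, List (Fin (n i))

/-- The Hilbert space `ℓ²(A)` for a set `A` of tuples of words, that is, the closed span in the
tensor product of full Fock spaces of the basis vectors indexed by `A`. -/
abbrev FockSpace {k : ℕ} {n : Fin k → ℕ} (A : Set (Words n)) : Type := lp (fun _ : A => ℂ) 2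

open scoped ComplexOrder

/-! ### Word tuples and coordinates in ℓ²(A) -/

namespace FockSpace

variable {k : ℕ} {n : Fin k → ℕ} {A : Set (Words n)}

/-- A set of tuples of words is suffix closed if it is stable under deleting first letters. -/
def SuffixClosed (A : Set (Words n)) : Prop :=
  ∀ α ∈ A, ∀ i, Function.update α i (α i).tail ∈ A

/-- Prefix a letter to the `i`-th word. -/
def push (i : Fin k) (j : Fin (n i)) (α : Words n) : Words n := Function.update α i (j :: α i)

/-- Delete the first letter of the `i`-th word. -/
def pop (i : Fin k) (α : Words n) : Words n := Function.update α i (α i).tail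

@[simp] lemma pop_push (i : Fin k) (j : Fin (n i)) (α : Words n) : pop i (push i j α) = α := by
  simp [pop, push]

lemma push_pop {i : Fin k} {j : Fin (n i)} {α : Words n} (h : (α i).head? = some j) :
    push i j (pop i α) = α := by
  have : j :: (α i).tail = α i := by
    cases h' : α i <;> simp_all
  simp [pop, push, this]

lemma pop_of_ne {i l : Fin k} (h : l ≠ i) (α : Words n) : pop i α l = α l := by
  simp [pop, h]

lemma pop_comm (i l : Fin k) (h : i ≠ l) (α : Words n) : pop i (pop l α) = pop l (pop i α) := by
  rw [pop, pop_of_ne h, pop, pop, pop_of_ne h.symm, pop, Function.update_comm h]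

@[simp] lemma head?_push (i : Fin k) (j : Fin (n i)) (α : Words n) :
    (push i j α i).head? = some j := by
  simp [push]

lemma SuffixClosed.pop_mem (hA : SuffixClosed A) {α : Words n} (h : α ∈ A) (i : Fin k) :
    pop i α ∈ A := hA α h i

lemma SuffixClosed.of_push_mem (hA : SuffixClosed A) {α : Words n} {i : Fin k} {j : Fin (n i)}
    (h : push i j α ∈ A) : α ∈ A := by
  simpa using hA.pop_mem h i

open Classical in
/-- The coefficient at a tuple of words, which is `0` for tuples outside `A`. -/
noncomputable def coeff (γ : Words n) : FockSpace A →ₗ[ℂ] ℂ where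
  toFun f := if h : γ ∈ A then f ⟨γ, h⟩ else 0
  map_add' f g := by split_ifs <;> simp
  map_smul' c f := by split_ifs <;> simp

lemma coeff_of_mem {γ : Words n} (h : γ ∈ A) (f : FockSpace A) : coeff γ f = f ⟨γ, h⟩ := by
  simp [coeff, h]

lemma coeff_of_notMem {γ : Words n} (h : γ ∉ A) (f : FockSpace A) : coeff γ f = 0 := by
  simp [coeff, h]

lemma ext_coeff {f g : FockSpace A} (h : ∀ γ ∈ A, coeff γ f = coeff γ g) : f = g := by
  ext ⟨γ, hγ⟩
  simpa [coeff_of_mem hγ] using h γ hγ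

open Classical in
/-- The basis vector at a tuple of words, which is `0` for tuples outside `A`. -/
noncomputable def basisVec (A : Set (Words n)) (γ : Words n) : FockSpace A :=
  if h : γ ∈ A then lp.single 2 ⟨γ, h⟩ 1 else 0

lemma basisVec_of_notMem {γ : Words n} (h : γ ∉ A) : basisVec A γ = 0 := by
  simp [basisVec, h]

open Classical in
lemma coeff_basisVec (γ δ : Words n) :
    coeff δ (basisVec A γ) = if δ = γ ∧ γ ∈ A then 1 else 0 := by
  by_cases hδ : δ ∈ A
  · rw [coeff_of_mem hδ, basisVec]
    by_cases hγ : γ ∈ A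
    · simp [hγ, lp.single_apply, Pi.single_apply]
    · simp [hγ]
  · rw [coeff_of_notMem hδ, if_neg]
    rintro ⟨rfl, h⟩
    exact hδ h

lemma basisVec_ne_zero {γ : Words n} (h : γ ∈ A) : basisVec A γ ≠ 0 := fun h0 => by
  classical
  have := coeff_basisVec (A := A) γ γ
  simp [h0, h] at this

lemma inner_basisVec (γ : Words n) (f : FockSpace A) :
    inner ℂ (basisVec A γ) f = coeff γ f := by
  classical
  by_cases h : γ ∈ A
  · simp [basisVec, h, coeff_of_mem h, lp.inner_single_left]
  · simp [basisVec, h, coeff_of_notMem h]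

lemma sum_norm_coeff_sq_le (f : FockSpace A) (S : Finset (Words n)) :
    ∑ γ ∈ S, ‖coeff γ f‖ ^ 2 ≤ ‖f‖ ^ 2 := by
  classical
  have h1 : ∑ γ ∈ S, ‖coeff γ f‖ ^ 2 = ∑ γ ∈ S.filter (· ∈ A), ‖coeff γ f‖ ^ 2 := by
    rw [Finset.sum_filter]
    refine Finset.sum_congr rfl fun γ _ => ?_
    split_ifs with h
    · rfl
    · simp [coeff_of_notMem h]
  rw [h1, ← Finset.sum_subtype_eq_sum_filter]
  have h2 := lp.sum_rpow_le_norm_rpow (p := 2) (by simp) f (S.subtype (· ∈ A))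
  simp only [ENNReal.toReal_ofNat, Real.rpow_ofNat] at h2
  refine le_trans (le_of_eq (Finset.sum_congr rfl fun γ _ => ?_)) h2
  rw [coeff_of_mem γ.2]

/-! ### Compressed creation operators -/

open Classical in
lemma sum_norm_shift_sq_le (i : Fin k) (j : Fin (n i)) (f : FockSpace A) (s : Finset A) :
    ∑ α ∈ s, ‖if (α.1 i).head? = some j then coeff (pop i α.1) f else 0‖ ^ 2 ≤ ‖f‖ ^ 2 := by
  have h1 : ∑ α ∈ s, ‖if (α.1 i).head? = some j then coeff (pop i α.1) f else 0‖ ^ 2 =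
      ∑ α ∈ s.filter (fun α => (α.1 i).head? = some j), ‖coeff (pop i α.1) f‖ ^ 2 := by
    rw [Finset.sum_filter]
    refine Finset.sum_congr rfl fun γ _ => ?_
    split_ifs <;> simp
  rw [h1, ← Finset.sum_image (f := fun γ => ‖coeff γ f‖ ^ 2) (g := fun α : A => pop i α.1)]
  · exact sum_norm_coeff_sq_le f _
  -- Deleting the first letter is injective on tuples whose i-th word starts with g_j.
  · intro α hα β hβ h
    simp only [Finset.coe_filter, Set.mem_ofPred_eq] at hα hβ
    apply Subtype.ext
    rw [← push_pop hα.2, ← push_pop hβ.2]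
    exact congrArg _ h

open Classical in
/-- The compression to `ℓ²(A)` of the creation operator `e_α ↦ e_{g_j α}` on the `i`-th factor. -/
noncomputable def shift (A : Set (Words n)) (i : Fin k) (j : Fin (n i)) :
    FockSpace A →L[ℂ] FockSpace A :=
  LinearMap.mkContinuous
    { toFun := fun f => ⟨fun α => if (α.1 i).head? = some j then coeff (pop i α.1) f else 0,
        memℓp_gen' (C := ‖f‖ ^ 2) fun s => by
          simpa using sum_norm_shift_sq_le i j f s⟩
      map_add' := fun f g => by
        ext α
        simp only [lp.coeFn_add, Pi.add_apply, map_add]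
        split_ifs <;> simp
      map_smul' := fun c f => by
        ext α
        simp only [lp.coeFn_smul, Pi.smul_apply, map_smul]
        split_ifs <;> simp } 1 fun f => by
    rw [one_mul]
    refine lp.norm_le_of_forall_sum_le (by simp) (norm_nonneg f) fun s => ?_
    simpa using sum_norm_shift_sq_le i j f s

open Classical in
lemma coeff_shift {α : Words n} (h : α ∈ A) (i : Fin k) (j : Fin (n i)) (f : FockSpace A) :
    coeff α (shift A i j f) = if (α i).head? = some j then coeff (pop i α) f else 0 := by
  rw [coeff_of_mem h]
  rfl

/-- Suffix closure covers γ outside A: then the pushed tuple is outside A too, and both sides are 0.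
-/
lemma shift_basisVec (hA : SuffixClosed A) (i : Fin k) (j : Fin (n i)) (γ : Words n) :
    shift A i j (basisVec A γ) = basisVec A (push i j γ) := by
  classical
  refine ext_coeff fun α hα => ?_
  rw [coeff_shift hα, coeff_basisVec, coeff_basisVec]
  by_cases h : α = push i j γ
  · subst h
    simp [hα, hA.of_push_mem hα]
  · rw [if_neg (c := α = push i j γ ∧ _) (fun h' => h h'.1)]
    split_ifs with h1 h2
    · exact absurd (by rw [← h2.1, push_pop h1]) h
    · rfl
    · rfl

lemma coeff_adjoint_shift (hA : SuffixClosed A) (i : Fin k) (j : Fin (n i)) (β : Words n)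
    (f : FockSpace A) :
    coeff β (ContinuousLinearMap.adjoint (shift A i j) f) = coeff (push i j β) f := by
  rw [← inner_basisVec, ContinuousLinearMap.adjoint_inner_right, shift_basisVec hA,
    inner_basisVec]

lemma shift_commute (hA : SuffixClosed A) {s t : Fin k} (hst : s ≠ t) (a : Fin (n s))
    (b : Fin (n t)) : Commute (shift A s a) (shift A t b) := by
  classical
  refine ContinuousLinearMap.ext fun f => ext_coeff fun α hα => ?_
  simp only [mul_apply_eq_comp]
  rw [coeff_shift hα, coeff_shift hα, coeff_shift (hA.pop_mem hα _),
    coeff_shift (hA.pop_mem hα _), pop_of_ne hst, pop_of_ne hst.symm, pop_comm s t hst]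
  split_ifs <;> rfl

/-! ### Diagonal operators, positivity and purity -/

/-- `Y` is the diagonal operator with entries `u`. -/
def HasDiagonal (Y : FockSpace A →L[ℂ] FockSpace A) (u : Words n → ℝ) : Prop :=
  ∀ f, ∀ α ∈ A, coeff α (Y f) = u α * coeff α f

lemma hasDiagonal_one : HasDiagonal (1 : FockSpace A →L[ℂ] FockSpace A) fun _ => 1 := by
  intro f α _
  simp

lemma HasDiagonal.congr {Y : FockSpace A →L[ℂ] FockSpace A} {u v : Words n → ℝ}
    (h : HasDiagonal Y u) (huv : ∀ α, u α = v α) : HasDiagonal Y v := by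
  rwa [← funext huv]

-- Only the j equal to the first letter of α_i contributes: the adjoint deletes this letter and the
-- shift restores it. If α_i is empty, no j does.
open Classical in
lemma HasDiagonal.phi (hA : SuffixClosed A) {Y : FockSpace A →L[ℂ] FockSpace A} {u : Words n → ℝ}
    (hY : HasDiagonal Y u) (i : Fin k) :
    HasDiagonal (Phi (shift A i) Y) fun α => if α i = [] then 0 else u (pop i α) := by
  intro f α hα
  have h1 : coeff α (Phi (shift A i) Y f) =
      ∑ j, if (α i).head? = some j then u (pop i α) * coeff α f else 0 := by
    simp only [Phi, LinearMap.coe_mk, AddHom.coe_mk, _root_.sum_apply, map_sum,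
      mul_apply_eq_comp]
    refine Finset.sum_congr rfl fun j _ => ?_
    rw [coeff_shift hα]
    split_ifs with h
    · rw [hY _ _ (hA.pop_mem hα i), coeff_adjoint_shift hA, push_pop h]
    · rfl
  rw [h1]
  cases h : α i with
  | nil => simp [h]
  | cons j w => simp [h]

lemma HasDiagonal.phi_pow_one (hA : SuffixClosed A) (i : Fin k) (m : ℕ) :
    HasDiagonal ((Phi (shift A i) ^ m) 1) fun α => if m ≤ (α i).length then 1 else 0 := by
  induction m with
  | zero => simpa using hasDiagonal_one
  | succ m ih =>
    rw [pow_succ']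
    refine (ih.phi hA i).congr fun α => ?_
    cases h : α i <;> simp [pop, h]

open Classical in
lemma hasDiagonal_prod_one (hA : SuffixClosed A) (p : Fin k → ℕ) (hp : ∀ i, p i ≤ 1)
    (l : List (Fin k)) (hl : l.Nodup) :
    HasDiagonal ((l.map fun i => (1 - Phi (shift A i)) ^ p i).prod 1)
      fun α => if ∀ i ∈ l, p i = 1 → α i = [] then 1 else 0 := by
  induction l with
  | nil => simpa using hasDiagonal_one
  | cons i l ih =>
    rw [List.nodup_cons] at hl
    have ih := ih hl.2
    rw [List.map_cons, List.prod_cons]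
    rcases Nat.le_one_iff_eq_zero_or_eq_one.mp (hp i) with h0 | h1
    · rw [h0, pow_zero, one_mul]
      refine ih.congr fun α => ?_
      simp [h0]
    · rw [h1, pow_one, Module.End.mul_apply]
      intro f α hα
      rw [LinearMap.sub_apply, Module.End.one_apply, _root_.sub_apply, map_sub,
        ih f α hα, ih.phi hA i f α hα]
      -- Since i ∉ l, deleting a letter of α_i does not affect the conditions from l. The two terms
      -- therefore cancel unless α_i is empty.
      have hpop : (∀ r ∈ l, p r = 1 → pop i α r = []) ↔ ∀ r ∈ l, p r = 1 → α r = [] := by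
        refine forall₂_congr fun r hr => ?_
        rw [pop_of_ne (by rintro rfl; exact hl.1 hr)]
      simp only [hpop]
      by_cases hi : α i = [] <;> simp [hi, h1]

open Classical in
lemma hasDiagonal_defectMap (hA : SuffixClosed A) (p : Fin k → ℕ) (hp : ∀ i, p i ≤ 1) :
    HasDiagonal (defectMap (shift A) p 1) fun α => if ∀ i, p i = 1 → α i = [] then 1 else 0 := by
  rw [defectMap, List.ofFn_eq_map]
  simpa using hasDiagonal_prod_one hA p hp (List.finRange k) (List.nodup_finRange k)

lemma HasDiagonal.isPositive {Y : FockSpace A →L[ℂ] FockSpace A} {u : Words n → ℝ}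
    (hY : HasDiagonal Y u) (hu : ∀ α, 0 ≤ u α) : Y.IsPositive := by
  have key : ∀ f (α : A), Y f α = u α * f α := fun f α => by
    simpa [coeff_of_mem α.2] using hY f α.1 α.2
  rw [ContinuousLinearMap.isPositive_iff]
  refine ⟨fun f g => ?_, fun f => ?_⟩
  · simp only [ContinuousLinearMap.coe_coe, lp.inner_eq_tsum]
    refine tsum_congr fun α => ?_
    simp only [key, RCLike.inner_apply, map_mul, Complex.conj_ofReal]
    ring
  · rw [lp.inner_eq_tsum]
    refine tsum_nonneg fun α => ?_
    have : inner ℂ (Y f α) (f α) = ((u α * ‖f α‖ ^ 2 : ℝ) : ℂ) := by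
      rw [key, RCLike.inner_apply, map_mul, Complex.conj_ofReal, mul_left_comm, RCLike.mul_conj]
      simp
    rw [this]
    exact_mod_cast mul_nonneg (hu α) (sq_nonneg _)

lemma inPolyball_shift (hA : SuffixClosed A) : InPolyball (shift A) where
  commute _ _ hst a b := shift_commute hA hst a b
  defect_nonneg p hp := by
    classical
    refine (hasDiagonal_defectMap hA p hp).isPositive fun α => ?_
    split_ifs <;> simp

lemma isPure_shift (hA : SuffixClosed A) : IsPure (shift A) := by
  intro i h
  have key : ∀ m, ‖(Phi (shift A i) ^ m) 1 h‖ ^ 2 =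
      ∑' α : A, (if m ≤ (α.1 i).length then ‖h α‖ ^ 2 else 0) := fun m => by
    have := lp.norm_rpow_eq_tsum (p := 2) (by simp) ((Phi (shift A i) ^ m) 1 h)
    simp only [ENNReal.toReal_ofNat, Real.rpow_ofNat] at this
    rw [this]
    refine tsum_congr fun α => ?_
    have := HasDiagonal.phi_pow_one hA i m h α.1 α.2
    rw [coeff_of_mem α.2, coeff_of_mem α.2] at this
    rw [this]
    by_cases hm : m ≤ (α.1 i).length <;> simp [hm]
  have hsum : Summable fun α : A => ‖h α‖ ^ 2 := by
    simpa using (lp.memℓp h).summable (by simp)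
  have h0 : Filter.Tendsto (fun m : ℕ => ‖(Phi (shift A i) ^ m) 1 h‖ ^ 2) Filter.atTop
      (nhds (∑' _ : A, 0)) := by
    simp only [key]
    -- Each term vanishes once m exceeds the length of α_i, and ‖h α‖² dominates.
    refine tendsto_tsum_of_dominated_convergence hsum (fun α => ?_) (.of_forall fun m α => ?_)
    · refine tendsto_const_nhds.congr' ?_
      filter_upwards [Filter.eventually_gt_atTop (α.1 i).length] with m hm
      rw [if_neg (by omega)]
    · split_ifs <;> simp
  rw [tsum_zero] at h0
  rw [tendsto_zero_iff_norm_tendsto_zero]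
  simpa using h0.sqrt

/-! ### The vacuum, rank and dimension of M_q -/

/-- The tuple of empty words. -/
def vac (n : Fin k → ℕ) : Words n := fun _ => []

lemma defect_shift_apply (hA : SuffixClosed A) (hvac : vac n ∈ A) (f : FockSpace A) :
    defect (shift A) f = coeff (vac n) f • basisVec A (vac n) := by
  classical
  refine ext_coeff fun α hα => ?_
  rw [defect, hasDiagonal_defectMap hA _ (fun _ => le_rfl) f α hα, map_smul, coeff_basisVec]
  by_cases h : α = vac n
  · subst h
    simp [hvac, vac]
  · have h' : ∃ i, α i ≠ [] := by
      by_contra! h'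
      exact h (funext h')
    simp [h, h']

lemma range_defect_shift (hA : SuffixClosed A) (hvac : vac n ∈ A) :
    LinearMap.range (defect (shift A)).toLinearMap = Submodule.span ℂ {basisVec A (vac n)} := by
  classical
  ext x
  rw [LinearMap.mem_range, Submodule.mem_span_singleton]
  constructor
  · rintro ⟨f, rfl⟩
    exact ⟨_, (defect_shift_apply hA hvac f).symm⟩
  · rintro ⟨c, rfl⟩
    refine ⟨c • basisVec A (vac n), ?_⟩
    rw [ContinuousLinearMap.coe_coe, defect_shift_apply hA hvac, map_smul, coeff_basisVec]
    simp [hvac]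

lemma rank_shift (hA : SuffixClosed A) (hvac : vac n ∈ A) : rank (shift A) = 1 := by
  rw [rank, LinearMap.rank, range_defect_shift hA hvac,
    ← Module.finrank_eq_rank, finrank_span_singleton (basisVec_ne_zero hvac), Nat.cast_one]

lemma prod_map_shift_basisVec (hA : SuffixClosed A) (i : Fin k) (w : List (Fin (n i)))
    (γ : Words n) :
    (w.map (shift A i)).prod (basisVec A γ) =
      basisVec A (Function.update γ i (w ++ γ i)) := by
  induction w with
  | nil => simp
  | cons j w ih =>
    rw [List.map_cons, List.prod_cons, mul_apply_eq_comp, ih, shift_basisVec hA]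
    simp [push]

open Classical in
lemma prod_wordOp_basisVec (hA : SuffixClosed A) (α γ : Words n) (l : List (Fin k))
    (hl : l.Nodup) :
    (l.map fun i => ((α i).map (shift A i)).prod).prod (basisVec A γ) =
      basisVec A (fun i => if i ∈ l then α i ++ γ i else γ i) := by
  induction l with
  | nil => simp
  | cons i l ih =>
    rw [List.nodup_cons] at hl
    rw [List.map_cons, List.prod_cons, mul_apply_eq_comp, ih hl.2,
      prod_map_shift_basisVec hA]
    congr 1
    ext1 r
    by_cases h : r = i
    · subst h
      simp [hl.1]
    · simp [h]

/-- For α outside A this says that the word operator kills the vacuum, which is how A is read off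
from the operators. -/
lemma wordOp_shift_basisVec (hA : SuffixClosed A) (α : Words n) :
    wordOp (shift A) α (basisVec A (vac n)) = basisVec A α := by
  classical
  rw [wordOp, List.ofFn_eq_map, prod_wordOp_basisVec hA _ _ _ (List.nodup_finRange k)]
  simp [vac]

lemma M_shift (hA : SuffixClosed A) (hvac : vac n ∈ A) (q : Fin k → ℕ) :
    M (shift A) q =
      Submodule.span ℂ (Set.range fun α : {α | α ∈ A ∧ ∀ i, (α i).length ≤ q i} =>
        basisVec A α.1) := by
  apply le_antisymm
  · rw [M, Submodule.span_le]
    rintro _ ⟨α, hα, _, ⟨f, rfl⟩, rfl⟩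
    rw [SetLike.mem_coe, defect_shift_apply hA hvac, map_smul, wordOp_shift_basisVec hA]
    refine Submodule.smul_mem _ _ ?_
    by_cases h : α ∈ A
    · exact Submodule.subset_span ⟨⟨α, h, hα⟩, rfl⟩
    · rw [basisVec_of_notMem h]
      exact zero_mem _
  · rw [Submodule.span_le]
    rintro _ ⟨⟨α, h, hα⟩, rfl⟩
    refine Submodule.subset_span ⟨α, hα, basisVec A (vac n), ?_, (wordOp_shift_basisVec hA α).symm⟩
    have : basisVec A (vac n) ∈ LinearMap.range (defect (shift A)).toLinearMap := by
      rw [range_defect_shift hA hvac]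
      exact Submodule.mem_span_singleton_self _
    exact this

lemma orthonormal_basisVec (A : Set (Words n)) : Orthonormal ℂ fun α : A => basisVec A α.1 := by
  classical
  rw [orthonormal_iff_ite]
  intro α β
  rw [inner_basisVec, coeff_basisVec]
  simp [Subtype.ext_iff]

lemma finrank_M_shift (hA : SuffixClosed A) (hvac : vac n ∈ A) (q : Fin k → ℕ) :
    Module.finrank ℂ (M (shift A) q) = {α | α ∈ A ∧ ∀ i, (α i).length ≤ q i}.ncard := by
  have hfin : {α : Words n | α ∈ A ∧ ∀ i, (α i).length ≤ q i}.Finite := by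
    refine (Set.Finite.pi' (t := fun i => {w : List (Fin (n i)) | w.length ≤ q i})
      fun i => List.finite_length_le _ _).subset fun α hα => hα.2
  have := hfin.fintype
  rw [M_shift hA hvac, finrank_span_eq_card, ← Nat.card_eq_fintype_card, Nat.card_coe_set_eq]
  exact (orthonormal_basisVec A).linearIndependent.comp
    (fun α : {α | α ∈ A ∧ ∀ i, (α i).length ≤ q i} => (⟨α.1, α.2.1⟩ : A))
    fun α β h => Subtype.ext (congrArg (fun γ : A => γ.1) h)

/-- Every other basis vector is in the range of a shift, namely the one for the first letter of a
nonempty α_i. -/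
lemma eq_smul_basisVec_vac (hvac : vac n ∈ A) (x : FockSpace A)
    (hx : ∀ i (j : Fin (n i)) f, inner ℂ (shift A i j f) x = 0) (hA : SuffixClosed A) :
    x = coeff (vac n) x • basisVec A (vac n) := by
  classical
  refine ext_coeff fun α hα => ?_
  rw [map_smul, coeff_basisVec]
  by_cases h : α = vac n
  · subst h
    simp [hvac]
  · obtain ⟨i, hi⟩ : ∃ i, α i ≠ [] := by
      by_contra! h'
      exact h (funext h')
    obtain ⟨j, w, hj⟩ := List.exists_cons_of_ne_nil hi
    have hx' := hx i j (basisVec A (pop i α))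
    rw [shift_basisVec hA, push_pop (by simp [hj]), inner_basisVec] at hx'
    simp [h, hx']

lemma inner_shift_basisVec_vac (i : Fin k) (j : Fin (n i)) (f : FockSpace A) :
    inner ℂ (shift A i j f) (basisVec A (vac n)) = 0 := by
  classical
  by_cases hvac : vac n ∈ A
  · rw [← inner_conj_symm, inner_basisVec, coeff_shift hvac]
    simp [vac]
  · simp [basisVec_of_notMem hvac]

end FockSpace

lemma map_list_prod_apply {H H' ι : Type*} [NormedAddCommGroup H] [InnerProductSpace ℂ H]
    [NormedAddCommGroup H'] [InnerProductSpace ℂ H'] (U : H → H') (W : ι → H →L[ℂ] H)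
    (W' : ι → H' →L[ℂ] H') (h : ∀ i x, U (W i x) = W' i (U x)) (l : List ι) (x : H) :
    U ((l.map W).prod x) = (l.map W').prod (U x) := by
  induction l with
  | nil => simp
  | cons i l ih => simp [h, ih]

namespace FockSpace

variable {k : ℕ} {n : Fin k → ℕ} {A B : Set (Words n)}

lemma eq_of_unitarilyEquivalent (hA : SuffixClosed A) (hB : SuffixClosed B) (hvA : vac n ∈ A)
    (hvB : vac n ∈ B) (h : UnitarilyEquivalent (shift A) (shift B)) : A = B := by
  obtain ⟨U, hU⟩ := h
  have hword : ∀ α x, U (wordOp (shift A) α x) = wordOp (shift B) α (U x) := fun α x => by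
    rw [wordOp, wordOp, List.ofFn_eq_map, List.ofFn_eq_map]
    exact map_list_prod_apply U _ _ (fun i y => map_list_prod_apply U _ _ (hU i) _ y) _ x
  obtain ⟨c, hc⟩ : ∃ c : ℂ, U (basisVec A (vac n)) = c • basisVec B (vac n) := by
    refine ⟨_, eq_smul_basisVec_vac hvB _ (fun i j f => ?_) hB⟩
    obtain ⟨g, rfl⟩ := U.surjective f
    rw [← hU, U.inner_map_map, inner_shift_basisVec_vac]
  have hc0 : c ≠ 0 := by
    rintro rfl
    rw [zero_smul, map_eq_zero_iff U U.injective] at hc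
    exact basisVec_ne_zero hvA hc
  ext α
  have h1 : U (basisVec A α) = c • basisVec B α := by
    rw [← wordOp_shift_basisVec hA, hword, hc, map_smul, wordOp_shift_basisVec hB]
  constructor
  · intro hα
    by_contra hβ
    rw [basisVec_of_notMem hβ, smul_zero, map_eq_zero_iff U U.injective] at h1
    exact basisVec_ne_zero hα h1
  · intro hβ
    by_contra hα
    rw [basisVec_of_notMem hα, map_zero, eq_comm, smul_eq_zero] at h1
    exact h1.elim hc0 (basisVec_ne_zero hβ)

end FockSpace
end Polyball

/-! ### Sets of words of prescribed density -/

namespace Polyball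

/-- A word of length `p` encodes the rational number `∑ l, j_l n ^ (l - 1 - p)`; this is the set
of words for which it is less than `c`. -/
def cutWords (n : ℕ) (c : ℝ) : Set (List (Fin n)) :=
  {w | ((Nat.ofDigits n (w.map Fin.val) : ℕ) : ℝ) < c * (n : ℝ) ^ w.length}

lemma nil_mem_cutWords {n : ℕ} {c : ℝ} (hc : 0 < c) : [] ∈ cutWords n c := by
  simpa [cutWords] using hc

/-- The first letter is the least significant digit, so deleting it truncates the encoded fraction
and cannot increase it. -/
lemma tail_mem_cutWords {n : ℕ} (hn : 2 ≤ n) {c : ℝ} {w : List (Fin n)} (hw : w ∈ cutWords n c) :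
    w.tail ∈ cutWords n c := by
  cases w with
  | nil => exact hw
  | cons j w =>
    simp only [cutWords, Set.mem_ofPred_eq, List.map_cons, Nat.ofDigits_cons, List.length_cons,
      List.tail_cons, Nat.cast_add, Nat.cast_mul, pow_succ'] at hw ⊢
    have hn0 : (0 : ℝ) < n := by positivity
    have hj : (0 : ℝ) ≤ (j : ℕ) := by positivity
    refine lt_of_mul_lt_mul_left ?_ hn0.le
    linarith

/-- Words of a given length are enumerated by their base `n` values. -/
lemma bijOn_ofDigits_map_val {n : ℕ} (hn : 2 ≤ n) (p : ℕ) :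
    Set.BijOn (fun w : List (Fin n) => Nat.ofDigits n (w.map Fin.val)) {w | w.length = p}
      {m | m < n ^ p} := by
  refine ⟨fun w hw => ?_, fun w hw w' hw' h => ?_, fun m hm => ?_⟩
  · have := Nat.ofDigits_lt_base_pow_length (b := n) (l := w.map Fin.val) (by omega) (by simp)
    rw [List.length_map, hw] at this
    exact this
  · refine List.map_injective_iff.mpr Fin.val_injective
      (Nat.ofDigits_inj_of_len_eq (b := n) (by omega) ?_ (by simp) (by simp) h)
    rw [List.length_map, List.length_map, hw, hw']
  · obtain ⟨L, ⟨hL, hLn⟩, rfl⟩ := (Nat.bijOn_ofDigits (b := n) (by omega) p).surjOn hm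
    refine ⟨L.pmap Fin.mk hLn, by simpa using hL, ?_⟩
    simp [List.map_pmap]

lemma ncard_cutWords_length_eq {n : ℕ} (hn : 2 ≤ n) {c : ℝ} (hc : c ≤ 1) (p : ℕ) :
    {w | w ∈ cutWords n c ∧ w.length = p}.ncard = ⌈c * (n : ℝ) ^ p⌉₊ := by
  have hbij := bijOn_ofDigits_map_val hn p
  have himg : (fun w : List (Fin n) => Nat.ofDigits n (w.map Fin.val)) ''
      {w | w ∈ cutWords n c ∧ w.length = p} = Finset.range ⌈c * (n : ℝ) ^ p⌉₊ := by
    ext m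
    simp only [Set.mem_image, Finset.coe_range, Set.mem_Iio, Nat.lt_ceil]
    constructor
    · rintro ⟨w, ⟨hw, rfl⟩, rfl⟩
      exact hw
    · intro hm
      -- As c ≤ 1, every integer below c n^p is the value of a word of length p.
      have hmp : m < n ^ p := by
        have : (m : ℝ) < (n : ℝ) ^ p :=
          hm.trans_le (mul_le_of_le_one_left (by positivity) hc)
        exact_mod_cast this
      obtain ⟨w, hw, rfl⟩ := hbij.surjOn hmp
      refine ⟨w, ⟨?_, hw⟩, rfl⟩
      rw [Set.mem_ofPred_eq] at hw
      rwa [cutWords, Set.mem_ofPred_eq, hw]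
  rw [← (hbij.injOn.mono fun w hw => hw.2).ncard_image, himg, Set.ncard_coe_finset,
    Finset.card_range]

lemma ncard_cutWords_length_le {n : ℕ} (hn : 2 ≤ n) {c : ℝ} (hc : c ≤ 1) (p : ℕ) :
    {w | w ∈ cutWords n c ∧ w.length ≤ p}.ncard =
      ∑ s ∈ Finset.range (p + 1), ⌈c * (n : ℝ) ^ s⌉₊ := by
  have hfin : ∀ p, {w | w ∈ cutWords n c ∧ w.length ≤ p}.Finite := fun p =>
    (List.finite_length_le _ _).subset fun w hw => hw.2
  induction p with
  | zero => simpa using ncard_cutWords_length_eq hn hc 0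
  | succ p ih =>
    rw [Finset.sum_range_succ, ← ih, ← ncard_cutWords_length_eq hn hc, ← Set.ncard_union_eq ?_
      (hfin p) ((hfin (p + 1)).subset fun w hw => ⟨hw.1, hw.2.le⟩)]
    · congr 1
      ext w
      simp only [Set.mem_ofPred_eq, Set.mem_union, ← and_or_left, Nat.le_add_one_iff]
    · rw [Set.disjoint_left]
      rintro w ⟨_, h⟩ ⟨_, h'⟩
      omega

/-- Rounding up costs at most 1 per length, in total p + 1, against a denominator of at least n^p.
-/
lemma tendsto_cutWords_ratio {n : ℕ} (hn : 2 ≤ n) {c : ℝ} (hc0 : 0 ≤ c) :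
    Filter.Tendsto (fun p : ℕ => ((∑ s ∈ Finset.range (p + 1), ⌈c * (n : ℝ) ^ s⌉₊ : ℕ) : ℝ) /
      ∑ s ∈ Finset.range (p + 1), (n : ℝ) ^ s) Filter.atTop (nhds c) := by
  have hn1 : (1 : ℝ) < n := by exact_mod_cast hn
  have hpos : ∀ p : ℕ, 0 < ∑ s ∈ Finset.range (p + 1), (n : ℝ) ^ s := fun p =>
    Finset.sum_pos (fun s _ => by positivity) ⟨0, by simp⟩
  have hlim : Filter.Tendsto (fun p : ℕ => c + (p + 1 : ℕ) / (n : ℝ) ^ p) Filter.atTop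
      (nhds c) := by
    have h1 := tendsto_pow_const_div_const_pow_of_one_lt 1 hn1
    have h2 := tendsto_pow_const_div_const_pow_of_one_lt 0 hn1
    have := (h1.add h2).const_add c
    simp only [add_zero] at this
    refine this.congr fun p => ?_
    push_cast
    ring
  refine tendsto_of_tendsto_of_tendsto_of_le_of_le tendsto_const_nhds hlim (fun p => ?_)
    fun p => ?_
  · rw [le_div_iff₀ (hpos p), Finset.mul_sum, Nat.cast_sum]
    exact Finset.sum_le_sum fun s _ => Nat.le_ceil _
  · have h1 : ((∑ s ∈ Finset.range (p + 1), ⌈c * (n : ℝ) ^ s⌉₊ : ℕ) : ℝ) ≤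
        c * ∑ s ∈ Finset.range (p + 1), (n : ℝ) ^ s + (p + 1 : ℕ) := by
      have : ((p + 1 : ℕ) : ℝ) = ∑ s ∈ Finset.range (p + 1), (1 : ℝ) := by simp
      rw [this, Finset.mul_sum, Nat.cast_sum, ← Finset.sum_add_distrib]
      exact Finset.sum_le_sum fun s _ => (Nat.ceil_lt_add_one (by positivity)).le
    have h2 : (n : ℝ) ^ p ≤ ∑ s ∈ Finset.range (p + 1), (n : ℝ) ^ s :=
      Finset.single_le_sum (f := fun s => (n : ℝ) ^ s) (fun s _ => by positivity) (by simp)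
    calc _ ≤ (c * ∑ s ∈ Finset.range (p + 1), (n : ℝ) ^ s + (p + 1 : ℕ)) /
          ∑ s ∈ Finset.range (p + 1), (n : ℝ) ^ s := by gcongr
      _ = c + (p + 1 : ℕ) / ∑ s ∈ Finset.range (p + 1), (n : ℝ) ^ s := by
        rw [add_div, mul_div_cancel_right₀ _ (hpos p).ne']
      _ ≤ _ := by gcongr

lemma cutWords_injOn {n : ℕ} (hn : 2 ≤ n) : Set.InjOn (cutWords n) (Set.Icc 0 1) := by
  intro c hc d hd h
  have hc' := tendsto_cutWords_ratio hn hc.1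
  have hd' := tendsto_cutWords_ratio hn hd.1
  simp only [← ncard_cutWords_length_le hn hc.2, ← ncard_cutWords_length_le hn hd.2] at hc' hd'
  rw [h] at hc'
  exact tendsto_nhds_unique hc' hd'

/-! ### Products of cut sets -/

namespace FockSpace

variable {k : ℕ} {n : Fin k → ℕ}

/-- The product of the sets `cutWords (n i) (c i)`. -/
def cutSet (n : Fin k → ℕ) (c : Fin k → ℝ) : Set (Words n) := {α | ∀ i, α i ∈ cutWords (n i) (c i)}

lemma suffixClosed_cutSet (hn : ∀ i, 2 ≤ n i) (c : Fin k → ℝ) : SuffixClosed (cutSet n c) := by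
  intro α hα i l
  by_cases h : l = i
  · subst h
    simpa using tail_mem_cutWords (hn l) (hα l)
  · simpa [h] using hα l

lemma vac_mem_cutSet {c : Fin k → ℝ} (hc : ∀ i, 0 < c i) : vac n ∈ cutSet n c :=
  fun i => nil_mem_cutWords (hc i)

lemma ncard_cutSet (hn : ∀ i, 2 ≤ n i) {c : Fin k → ℝ} (hc : ∀ i, c i ≤ 1) (q : Fin k → ℕ) :
    {α | α ∈ cutSet n c ∧ ∀ i, (α i).length ≤ q i}.ncard =
      ∏ i, ∑ s ∈ Finset.range (q i + 1), ⌈c i * (n i : ℝ) ^ s⌉₊ := by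
  have h : {α | α ∈ cutSet n c ∧ ∀ i, (α i).length ≤ q i} =
      Set.univ.pi fun i => {w | w ∈ cutWords (n i) (c i) ∧ w.length ≤ q i} := by
    ext α
    simp [cutSet, forall_and]
  have hfin : ∀ i, {w | w ∈ cutWords (n i) (c i) ∧ w.length ≤ q i}.Finite := fun i =>
    (List.finite_length_le _ _).subset fun w hw => hw.2
  have := fun i => (hfin i).fintype
  rw [h, ← Nat.card_coe_set_eq, Nat.card_congr (Equiv.Set.univPi _), Nat.card_pi]
  exact Finset.prod_congr rfl fun i _ => ncard_cutWords_length_le (hn i) (hc i) (q i)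

lemma hasEulerCharacteristic_cutSet (hn : ∀ i, 2 ≤ n i) {c : Fin k → ℝ} (hc0 : ∀ i, 0 < c i)
    (hc1 : ∀ i, c i ≤ 1) : HasEulerCharacteristic (shift (cutSet n c)) (∏ i, c i) := by
  have hA := suffixClosed_cutSet hn c
  have hvac := vac_mem_cutSet (n := n) hc0
  refine ⟨by rw [rank_shift hA hvac]; exact Cardinal.one_lt_aleph0, fun q hq hcof => ?_⟩
  simp only [eulerRatio, finrank_M_shift hA hvac, ncard_cutSet hn hc1, Nat.cast_prod,
    ← Finset.prod_div_distrib]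
  refine tendsto_finsetProd _ fun i _ => ?_
  refine (tendsto_cutWords_ratio (hn i) (hc0 i).le).comp
    (Filter.tendsto_atTop_atTop_of_monotone (fun a b h => hq h i) fun b => ?_)
  obtain ⟨m, hm⟩ := hcof fun _ => b
  exact ⟨m, hm i⟩

lemma cutSet_injOn (hn : ∀ i, 2 ≤ n i) :
    Set.InjOn (cutSet n) {c | ∀ i, c i ∈ Set.Ioc 0 1} := by
  intro c hc d hd h
  -- Each factor is the slice of the product through the vacuum; c_l > 0 puts the empty word in the
  -- other factors.
  have key : ∀ c : Fin k → ℝ, (∀ i, c i ∈ Set.Ioc 0 1) → ∀ i,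
      cutWords (n i) (c i) = {w | Function.update (vac n) i w ∈ cutSet n c} := by
    intro c hc i
    ext w
    constructor
    · intro hw l
      by_cases hl : l = i
      · subst hl
        simpa using hw
      · simpa [hl, vac] using nil_mem_cutWords (hc l).1
    · intro hw
      simpa using hw i
  ext i
  refine cutWords_injOn (hn i) (Set.Ioc_subset_Icc_self (hc i)) (Set.Ioc_subset_Icc_self (hd i)) ?_
  rw [key c hc, key d hd, h]

end FockSpace

/-- The densities `(s, t / s, 1, …, 1)`, with product `t`. -/
noncomputable def splitDensity {k : ℕ} (a b : Fin k) (t s : ℝ) : Fin k → ℝ :=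
  Function.update (Function.update 1 b (t / s)) a s

end Polyball

open Polyball Polyball.FockSpace in
theorem theorem2p6 (k : ℕ) (hk : 2 ≤ k) (n : Fin k → ℕ) (hn : ∀ i, 2 ≤ n i)
    (t : ℝ) (ht : t ∈ Set.Ioo (0 : ℝ) 1) :
    ∃ (Ω : Type) (H : Ω → Type)
      (_ : ∀ ω, NormedAddCommGroup (H ω)) (_ : ∀ ω, InnerProductSpace ℂ (H ω))
      (_ : ∀ ω, CompleteSpace (H ω))
      (T : ∀ ω, ∀ i, Fin (n i) → (H ω →L[ℂ] H ω)),
      Uncountable Ω ∧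
      (∀ ω, Polyball.InPolyball (T ω) ∧ Polyball.IsPure (T ω)) ∧
      (∀ ω σ, ω ≠ σ → ¬ Polyball.UnitarilyEquivalent (T ω) (T σ)) ∧
      (∀ ω, Polyball.rank (T ω) = 1 ∧ Polyball.HasEulerCharacteristic (T ω) t) := by
  obtain ⟨ht0, ht1⟩ := ht
  let a : Fin k := ⟨0, by omega⟩
  let b : Fin k := ⟨1, by omega⟩
  have hab : b ≠ a := by simp [a, b, Fin.ext_iff]
  -- The bound s > t keeps t / s below 1, and s is recovered as the density at a.
  let c : Set.Ioo t 1 → Fin k → ℝ := fun s => splitDensity a b t s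
  have hca : ∀ s, c s a = s := fun s => by simp [c, splitDensity]
  have hc : ∀ s i, c s i ∈ Set.Ioc 0 1 := by
    rintro ⟨s, hs⟩ i
    have hs0 : 0 < s := ht0.trans hs.1
    by_cases hia : i = a
    · rw [hia, hca]
      exact ⟨hs0, hs.2.le⟩
    by_cases hib : i = b
    · subst hib
      simp only [c, splitDensity, Function.update_of_ne hia, Function.update_self]
      exact ⟨by positivity, (div_le_one hs0).mpr hs.1.le⟩
    · simp [c, splitDensity, hia, hib]
  have hprod : ∀ s, ∏ i, c s i = t := by
    rintro ⟨s, hs⟩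
    have hs0 : s ≠ 0 := (ht0.trans hs.1).ne'
    simp only [c, splitDensity]
    rw [Finset.prod_update_of_mem (Finset.mem_univ a),
      Finset.prod_update_of_mem (by simpa using hab)]
    simp [mul_div_cancel₀ _ hs0]
  have hA := fun s => suffixClosed_cutSet hn (c s)
  have hvac := fun s => vac_mem_cutSet (n := n) fun i => (hc s i).1
  refine ⟨Set.Ioo t 1, fun s => FockSpace (cutSet n (c s)), fun _ => inferInstance,
    fun _ => inferInstance, fun _ => inferInstance, fun s => shift (cutSet n (c s)), ?_,
    fun s => ⟨inPolyball_shift (hA s), isPure_shift (hA s)⟩, fun s r hsr h => hsr ?_,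
    fun s => ⟨rank_shift (hA s) (hvac s), ?_⟩⟩
  · rw [← not_countable_iff, Set.countable_coe_iff, ← Cardinal.le_aleph0_iff_set_countable,
      Cardinal.mk_Ioo_real ht1, not_le]
    exact Cardinal.aleph0_lt_continuum
  · have := cutSet_injOn hn (hc s) (hc r)
      (eq_of_unitarilyEquivalent (hA s) (hA r) (hvac s) (hvac r) h)
    exact Subtype.ext (by rw [← hca s, ← hca r, this])
  · have := hasEulerCharacteristic_cutSet hn (fun i => (hc s i).1) fun i => (hc s i).2
    rwa [hprod] at this
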